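/- **Market.** Let $\mathcal I$ (agents), $\mathcal B$ (branches) and $\mathcal X$ (contracts) be finite sets; each contract $x$ names an agent $\mathbf i(x)$ and a branch $\mathbf b(x)$. Write $\mathcal X_i=\{x:\mathbf i(x)=i\}$ and $\mathcal X_b=\{x:\mathbf b(x)=b\}$. Each agent $i$ has a strict preference (linear order) $P_i$ over $\mathcal X_i\cup\{\emptyset\}$, where $\emptyset$ is her outside option; a contract is acceptable if it is preferred to $\emptyset$. **Choice rules (slot-specific priorities with capacity transfers, SSPwCT).** Branch $b$ has original seats $o_b^1,\dots,o_b^{n_b}$ and shadow seats $e_b^1,\dots,e_b^{n_b}$ (each kind numbered in order of precedence), a location vector $(l_1,\dots,l_{n_b})$ with $k\le l_k\le n_b$ and $l_k\ge l_{k-1}$, where $l_k$ is the number of original seats that precede $e_b^k$, and a transfer scheme $q_b\in\{0,1\}^{n_b}$. Each seat $s$ has a strict priority order $\Pi_b^s$ (a linear order) over $\mathcal X_b\cup\{\emptyset\}$. From a set $X\subseteq\mathcal X$ of offers, $C^b(X)$ is computed by going through the $2n_b$ seats in the resulting order: an original seat $s$ takes the $\Pi_b^s$-best contract, provided it is ranked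 above $\emptyset$, among the contracts in $X\cap\mathcal X_b$ of agents none of whose contracts was taken by an earlier seat (and stays empty if there is none); the shadow seat $e_b^k$ does the same if $o_b^k$ is empty and $q_b^k=1$, and stays empty otherwise. $C^b(X)$ is the set of all contracts taken. **Cumulative offer mechanism (COM).** Given $P=(P_i)_i$ and $C=(C^b)_b$, start with no offers. In each step an arbitrarily chosen agent, none of whose contracts is held, proposes her favorite acceptable contract among those not rejected so far; each branch $b$ holds $C^b(A_b)$, where $A_b$ is the set of all offers made to $b$ up to now, and rejects the other contracts in $A_b$. The algorithm stops when every agent either has a contract held or has had all her acceptable contracts rejected; its outcome is $\bigcup_b C^b(A_b)$. **Improvement.** Fix the location vectors and transfer schemes. The choice rules obtained from priorities $\overline\Pi$ are an improvement for agent $i$ over those obtained from $\Pi$ if for all branches $b$ and all seats $s$ of $b$: (1) for every contract $x\in\mathcal X_b$ of $i$ and every $y$ that is $\emptyset$ or a contract in $\mathcal X_b$ of another agent, $x\,\Pi_b^s\,y$ implies $x\,\overline\Pi_b^s\,y$; (2) for all $y,z$, each of which is $\emptyset$ or a contract in $\mathcal X_b$ of an agent other than $i$, $y\,\Pi_b^s\,z$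 if and only if $y\,\overline\Pi_b^s\,z$. **Theorem.** The COM with respect to SSPwCT choice rules respects improvements: for every agent $i$, every preference profile $P$ and all SSPwCT choice profiles $C,\overline C$ such that $\overline C$ is an improvement over $C$ for $i$, agent $i$ weakly prefers, with respect to $P_i$, her assignment (her only contract, or $\emptyset$ if she has none) under the COM at $(P,\overline C)$ to her assignment under the COM at $(P,C)$, whatever the order in which the agents are chosen to propose in the two runs. -/

import Mathlib

/-- A strict linear order on `α ∪ {∅}`; `none` is the null contract (the outside option), and
`r.above a b` means that `a` is ranked strictly above `b`. -/
structure StrictRanking (α : Type*) where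
  above : Option α → Option α → Prop
  irrefl : ∀ a, ¬ above a a
  trans : ∀ a b c, above a b → above b c → above a c
  total : ∀ a b, a ≠ b → above a b ∨ above b a

/-- The `r`-maximal element of `S`, as a set: the singleton of the best element of `S` if that one is
ranked above `∅`, and the empty set if no element of `S` is ranked above `∅` (for finite `S`). -/
def StrictRanking.top {α : Type*} (r : StrictRanking α) (S : Set α) : Set α :=
  {x | x ∈ S ∧ r.above (some x) none ∧ ∀ y ∈ S, y ≠ x → r.above (some x) (some y)}

/-- Strict preferences of every agent `i` over her own contracts and her outside option. -/
abbrev PrefProfile {I X : Type*} (agent : X → I) : Type _ :=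
  ∀ i : I, StrictRanking {x : X // agent x = i}

/-- The seats of a branch of physical capacity `n`: `Sum.inl k` is the `k`-th original seat and
`Sum.inr k` is the shadow seat associated with it. Seats of each of the two kinds are numbered in
their order of precedence. -/
abbrev Seat (n : ℕ) : Type := Fin n ⊕ Fin n

/-- A location vector: `loc k` is the number of original seats that precede the shadow seat with
(zero-based) index `k`. -/
structure LocationVector (n : ℕ) where
  loc : Fin n → ℕ
  lower : ∀ k : Fin n, (k : ℕ) + 1 ≤ loc k
  upper : ∀ k : Fin n, loc k ≤ n
  mono : Monotone loc

/-- The order in which all seats are filled: each original seat is followed by those shadow seats,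
in their order of precedence, that are preceded by exactly the original seats up to this one. -/
def LocationVector.seatList {n : ℕ} (L : LocationVector n) : List (Seat n) :=
  (List.finRange n).flatMap fun l =>
    Sum.inl l :: ((List.finRange n).filter fun k => L.loc k = (l : ℕ) + 1).map Sum.inr

/-- A capacity transfer scheme: `q k = true` iff the capacity of the `k`-th original seat is
transferred to its shadow seat when the original seat is not filled. -/
abbrev TransferScheme (n : ℕ) : Type := Fin n → Bool

/-- Priority orders of all seats of all branches; a seat of branch `b` ranks the contracts of `b`
and the null contract. -/
abbrev PriorityProfile {B X : Type*} (branch : X → B) (n : B → ℕ) : Type _ :=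
  ∀ b : B, Seat (n b) → StrictRanking {x : X // branch x = b}

/-- A choice rule maps a set of offered contracts to a set of chosen contracts. -/
abbrev ChoiceRule (X : Type*) : Type _ := Set X → Set X

/-- The seat-by-seat choice procedure from the set of offers `Y`. `chosen` is the set of contracts
assigned to the seats already processed and `filled` is the set of original seats filled so far.
An original seat takes its best contract among those of agents not chosen yet. A shadow seat does
the same if its original seat is empty and its transfer is allowed, and stays empty otherwise. -/
def fillSeats {I α : Type*} (agent : α → I) {n : ℕ} (q : TransferScheme n)
    (prio : Seat n → StrictRanking α) (Y : Set α) :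
    List (Seat n) → (chosen : Set α) → (filled : Set (Fin n)) → Set α
  | [], chosen, _ => chosen
  | Sum.inl k :: rest, chosen, filled =>
      let new := (prio (Sum.inl k)).top {x | x ∈ Y ∧ ∀ y ∈ chosen, agent y ≠ agent x}
      fillSeats agent q prio Y rest (chosen ∪ new) (filled ∪ {l | l = k ∧ new.Nonempty})
  | Sum.inr k :: rest, chosen, filled =>
      let new := {z | k ∉ filled ∧ q k = true ∧
        z ∈ (prio (Sum.inr k)).top {x | x ∈ Y ∧ ∀ y ∈ chosen, agent y ≠ agent x}}
      fillSeats agent q prio Y rest (chosen ∪ new) filled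

/-- The choice rule of branch `b` with slot-specific priorities and capacity transfers. -/
def sspwctChoice {I B X : Type*} (agent : X → I) (branch : X → B) {n : ℕ} (b : B)
    (L : LocationVector n) (q : TransferScheme n)
    (prio : Seat n → StrictRanking {x : X // branch x = b}) : ChoiceRule X :=
  fun S => Subtype.val ''
    fillSeats (fun x : {x : X // branch x = b} => agent x.1) q prio {x | x.1 ∈ S} L.seatList ∅ ∅

/-- The contracts held by the branches when `A` is the set of all offers made so far: the union over
`b` of the choices of `b` from the offers it received. -/
def heldContracts {B X : Type*} (branch : X → B) (C : B → ChoiceRule X) (A : Set X) : Set X :=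
  {x | ∃ b, x ∈ C b {y | y ∈ A ∧ branch y = b}}

/-- One step of the cumulative offer algorithm, from the offers `A` made so far to `A'`: some agent
`j`, for whom no branch holds a contract, proposes her favorite acceptable contract among those not
rejected yet. (As no contract of `j` is held, her rejected contracts are those that she has already
proposed, that is, those in `A`.) -/
def OfferStep {I B X : Type*} (agent : X → I) (branch : X → B) (P : PrefProfile agent)
    (C : B → ChoiceRule X) (A A' : Set X) : Prop :=
  ∃ j : I, (∀ y ∈ heldContracts branch C A, agent y ≠ j) ∧
    ∃ x ∈ (P j).top {y | y.1 ∉ A}, A' = insert x.1 A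

/-- The algorithm stops when every agent without a held contract has had all her acceptable
contracts rejected. -/
def OffersEnd {I B X : Type*} (agent : X → I) (branch : X → B) (P : PrefProfile agent)
    (C : B → ChoiceRule X) (A : Set X) : Prop :=
  ∀ j : I, (∃ y ∈ heldContracts branch C A, agent y = j) ∨
    ∀ x : {x : X // agent x = j}, (P j).above (some x) none → x.1 ∈ A

/-- The cumulative offer mechanism: all final outcomes of the cumulative offer algorithm, over all
ways to choose the proposing agents along the algorithm. -/
def cumulativeOffer {I B X : Type*} (agent : X → I) (branch : X → B) (P : PrefProfile agent)
    (C : B → ChoiceRule X) : Set (Set X) :=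
  {Z | ∃ A, Relation.ReflTransGen (OfferStep agent branch P C) ∅ A ∧
    OffersEnd agent branch P C A ∧ Z = heldContracts branch C A}

theorem StrictRanking.top_nonempty {α : Type*} [Finite α] (r : StrictRanking α) (S : Set α)
    (h : ∃ x ∈ S, r.above (some x) none) : (r.top S).Nonempty := by
  classical
  let R : α → α → Prop := fun a b => r.above (some a) (some b)
  have i1 : Std.Irrefl R := ⟨fun a => r.irrefl _⟩
  have i2 : IsTrans α R := ⟨fun a b c => r.trans _ _ _⟩
  have wf : WellFounded R := Finite.wellFounded_of_trans_of_irrefl R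
  obtain ⟨x, hx, hx0⟩ := h
  obtain ⟨m, hm, hmin⟩ := wf.has_min S ⟨x, hx⟩
  have key : ∀ y ∈ S, y ≠ m → r.above (some m) (some y) := fun y hy hne =>
    (r.total (some m) (some y) (by simpa using hne.symm)).resolve_right (hmin y hy)
  refine ⟨m, hm, ?_, key⟩
  by_cases e : x = m
  · exact e ▸ hx0
  · exact r.trans _ _ _ (key x hx e) hx0

/-- The algorithm always terminates: the mechanism returns some outcome. -/
theorem cumulativeOffer_nonempty {I B X : Type*} [Finite X] (agent : X → I) (branch : X → B)
    (P : PrefProfile agent) (C : B → ChoiceRule X) :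
    (cumulativeOffer agent branch P C).Nonempty := by
  have main : ∀ A : Set X, ∃ A', Relation.ReflTransGen (OfferStep agent branch P C) A A' ∧
      OffersEnd agent branch P C A' := by
    intro A
    induction A using WellFoundedGT.induction with
    | ind A ih =>
      by_cases h : OffersEnd agent branch P C A
      · exact ⟨A, .refl, h⟩
      · unfold OffersEnd at h
        push Not at h
        obtain ⟨j, hj, x, hx, hxA⟩ := h
        obtain ⟨m, hm⟩ := (P j).top_nonempty {y | y.1 ∉ A} ⟨x, hxA, hx⟩
        obtain ⟨A', h1, h2⟩ := ih (insert m.1 A) (Set.ssubset_insert hm.1)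
        exact ⟨A', .head ⟨j, hj, m, hm, rfl⟩ h1, h2⟩
  obtain ⟨A, h1, h2⟩ := main ∅
  exact ⟨_, A, h1, h2, rfl⟩

/-- `a` is the assignment of agent `i` in the outcome `Z`: `a` is her only contract in `Z`, or `a` is
the outside option and `Z` contains no contract of `i`. -/
def IsAssignment {I X : Type*} (agent : X → I) (i : I) (Z : Set X)
    (a : Option {x : X // agent x = i}) : Prop :=
  ∀ x : {x : X // agent x = i}, x.1 ∈ Z ↔ a = some x

/-- Agent `i` has a well-defined assignment in both outcomes and weakly prefers the one in `Z'` to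
the one in `Z`. -/
def WeaklyPrefers {I X : Type*} (agent : X → I) (P : PrefProfile agent) (i : I)
    (Z' Z : Set X) : Prop :=
  ∃ a' a, IsAssignment agent i Z' a' ∧ IsAssignment agent i Z a ∧ (a' = a ∨ (P i).above a' a)

/-- The priority profile `prio'` is an improvement over `prio` for agent `i`: at each seat of each
branch, every contract of `i` keeps its place above all contracts of other agents and the null
contract that it was ranked above, and the relative ranking of the other agents' contracts and the
null contract is unchanged. -/
def IsImprovement {I B X : Type*} (agent : X → I) (branch : X → B) {n : B → ℕ} (i : I)
    (prio' prio : PriorityProfile branch n) : Prop :=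
  ∀ (b : B) (s : Seat (n b)),
    (∀ (x : {x : X // branch x = b}) (y : Option {x : X // branch x = b}),
      agent x.1 = i → (∀ w ∈ y, agent w.1 ≠ i) →
      (prio b s).above (some x) y → (prio' b s).above (some x) y) ∧
    (∀ y z : Option {x : X // branch x = b},
      (∀ w ∈ y, agent w.1 ≠ i) → (∀ w ∈ z, agent w.1 ≠ i) →
      ((prio b s).above y z ↔ (prio' b s).above y z))

/-- A mechanism `Φ` respects improvements with respect to the choice rules with the given location
vectors and transfer schemes: every agent weakly prefers any outcome that `Φ` can return under an
improvement for her to any outcome that it can return under the original priorities. -/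
def RespectsImprovements {I B X : Type*} (agent : X → I) (branch : X → B) {n : B → ℕ}
    (L : ∀ b, LocationVector (n b)) (q : ∀ b, TransferScheme (n b))
    (Φ : PrefProfile agent → (B → ChoiceRule X) → Set (Set X)) : Prop :=
  ∀ (i : I) (P : PrefProfile agent) (prio' prio : PriorityProfile branch n),
    IsImprovement agent branch i prio' prio →
    ∀ Z' ∈ Φ P (fun b => sspwctChoice agent branch b (L b) (q b) (prio' b)),
    ∀ Z ∈ Φ P (fun b => sspwctChoice agent branch b (L b) (q b) (prio b)),
      WeaklyPrefers agent P i Z' Z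

/-! SSPwCT choice rules need not be substitutable, so the proof replaces them by a completion `H`:
the same seat-by-seat procedure, except that an agent may receive several contracts. `H` is
substitutable (`mem_relaxedFill_of_subset`) and satisfies the law of aggregate demand
(`ncard_relaxedFill_le`). It agrees with the true rule whenever it gives no agent two contracts
(`fillSeats_eq_relaxedFill`), and this holds at every state of the algorithm.

Write `H'` for the completion under the improved priorities. If `H'` chooses no contract of `i` from
some offers, then `H` makes the same choice from them (`relaxedFill_eq_of_improves`).

Suppose that `i` strictly preferred her old assignment `x` to her new one. At some point of the
improved run she holds nothing and has already offered every contract better than her new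
assignment, `x` included. Letting only the others continue leads to a set of offers `E` from which
`H'`, and hence `H`, gives `i` nothing. All offers `A` of the old run lie in `E`, so every agent
served in `H E` is served in `H A`, while `i` is served only in `H A`. Thus `H E` is smaller than `H
A`, against the law of aggregate demand. -/

theorem StrictRanking.asymm {α : Type*} (r : StrictRanking α) {a b : Option α}
    (h : r.above a b) : ¬ r.above b a :=
  fun h' => r.irrefl a (r.trans _ _ _ h h')

theorem StrictRanking.top_subsingleton {α : Type*} (r : StrictRanking α) (S : Set α) :
    (r.top S).Subsingleton := by
  intro x hx y hy
  by_contra h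
  exact r.asymm (hx.2.2 y hy.1 (Ne.symm h)) (hy.2.2 x hx.1 h)

theorem StrictRanking.top_nonempty_mono {α : Type*} [Finite α] (r : StrictRanking α)
    {S T : Set α} (hST : S ⊆ T) (h : (r.top S).Nonempty) : (r.top T).Nonempty := by
  obtain ⟨x, hx⟩ := h
  exact r.top_nonempty T ⟨x, hST hx.1, hx.2.1⟩

theorem StrictRanking.mem_top_of_subset {α : Type*} (r : StrictRanking α)
    {S T : Set α} (hST : S ⊆ T) {x : α} (h : x ∈ r.top T) (hx : x ∈ S) : x ∈ r.top S :=
  ⟨hx, h.2.1, fun y hy => h.2.2 y (hST hy)⟩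

/-- Irrelevance of rejected contracts; an empty choice from `T` is covered too, since a nonempty
choice from `S` would force one from `T`. -/
theorem StrictRanking.top_eq_of_subset {α : Type*} [Finite α] (r : StrictRanking α)
    {S T : Set α} (hST : S ⊆ T) (h : r.top T ⊆ S) : r.top S = r.top T := by
  apply Set.Subset.antisymm
  · intro x hx
    obtain ⟨y, hy⟩ := r.top_nonempty_mono hST ⟨x, hx⟩
    rwa [r.top_subsingleton S hx (r.mem_top_of_subset hST hy (h hy))]
  · exact fun x hx => r.mem_top_of_subset hST hx (h hx)

/-! ### The relaxed choice procedure: substitutability and aggregate demand -/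

/-- The seat-by-seat choice procedure in which an agent may obtain several contracts: the only
contracts that are unavailable to a seat are those taken by earlier seats. -/
def relaxedFill {α : Type*} {n : ℕ} (q : TransferScheme n)
    (prio : Seat n → StrictRanking α) (Y : Set α) :
    List (Seat n) → (chosen : Set α) → (filled : Set (Fin n)) → Set α
  | [], chosen, _ => chosen
  | Sum.inl k :: rest, chosen, filled =>
      let new := (prio (Sum.inl k)).top (Y \ chosen)
      relaxedFill q prio Y rest (chosen ∪ new) (filled ∪ {l | l = k ∧ new.Nonempty})
  | Sum.inr k :: rest, chosen, filled =>
      let new := {z | k ∉ filled ∧ q k = true ∧ z ∈ (prio (Sum.inr k)).top (Y \ chosen)}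
      relaxedFill q prio Y rest (chosen ∪ new) filled

section RelaxedFill

variable {I α : Type*} {n : ℕ} {q : TransferScheme n}

theorem subset_relaxedFill {prio : Seat n → StrictRanking α} {Y : Set α} (l : List (Seat n))
    (chosen : Set α) (filled : Set (Fin n)) : chosen ⊆ relaxedFill q prio Y l chosen filled := by
  induction l generalizing chosen filled with
  | nil => exact subset_rfl
  | cons s l ih =>
    rcases s with k | k <;> exact Set.subset_union_left.trans (ih _ _)

theorem relaxedFill_subset {prio : Seat n → StrictRanking α} {Y : Set α} (l : List (Seat n))
    (chosen : Set α) (filled : Set (Fin n)) (h : chosen ⊆ Y) :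
    relaxedFill q prio Y l chosen filled ⊆ Y := by
  induction l generalizing chosen filled with
  | nil => exact h
  | cons s l ih =>
    rcases s with k | k
    · exact ih _ _ (Set.union_subset h fun x hx => hx.1.1)
    · exact ih _ _ (Set.union_subset h fun x hx => hx.2.2.1.1)

/-- If no agent obtains two contracts in the relaxed procedure, it agrees with the original one. -/
theorem fillSeats_eq_relaxedFill [Finite α] (agent : α → I) {prio : Seat n → StrictRanking α}
    {Y : Set α} (l : List (Seat n)) (chosen : Set α) (filled : Set (Fin n))
    (h : Set.InjOn agent (relaxedFill q prio Y l chosen filled)) :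
    fillSeats agent q prio Y l chosen filled = relaxedFill q prio Y l chosen filled := by
  have key : ∀ (r : StrictRanking α) (c R : Set α), Set.InjOn agent R → c ⊆ R →
      r.top (Y \ c) ⊆ R →
      r.top {x | x ∈ Y ∧ ∀ y ∈ c, agent y ≠ agent x} = r.top (Y \ c) := by
    intro r c R hR hc ht
    apply r.top_eq_of_subset
    · exact fun x hx => ⟨hx.1, fun hxc => hx.2 x hxc rfl⟩
    -- A pick whose agent was served earlier would put two of her contracts into `R`.
    · intro x hx
      refine ⟨hx.1.1, fun y hy e => hx.1.2 ?_⟩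
      rwa [← hR (hc hy) (ht hx) e]
  induction l generalizing chosen filled with
  | nil => rfl
  | cons s l ih =>
    have hc := subset_relaxedFill (q := q) (prio := prio) (Y := Y) (s :: l) chosen filled
    rcases s with k | k
    · simp only [fillSeats, relaxedFill] at h hc ⊢
      rw [key _ chosen _ h hc (Set.subset_union_right.trans (subset_relaxedFill l _ _))]
      exact ih _ _ h
    · simp only [fillSeats, relaxedFill] at h hc ⊢
      by_cases hk : k ∉ filled ∧ q k = true
      · rw [key _ chosen _ h hc]
        · exact ih _ _ h
        · exact fun x hx => subset_relaxedFill l _ _ (Or.inr ⟨hk.1, hk.2, hx⟩)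
      · have e : ∀ T : Set α, {z | k ∉ filled ∧ q k = true ∧ z ∈ T} = ∅ := fun T =>
          Set.eq_empty_of_forall_notMem fun z hz => hk ⟨hz.1, hz.2.1⟩
        rw [e] at h ⊢
        rw [e]
        exact ih _ _ h

/-- Substitutability of the relaxed procedure. -/
theorem mem_relaxedFill_of_subset [Finite α] {prio : Seat n → StrictRanking α}
    {Y Y' : Set α} (l : List (Seat n)) (c c' : Set α) (f f' : Set (Fin n)) (hf : f ⊆ f')
    (hc : Y \ c ⊆ Y' \ c') :
    Y \ relaxedFill q prio Y l c f ⊆ Y' \ relaxedFill q prio Y' l c' f' := by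
  have key : ∀ (r : StrictRanking α) (c c' : Set α), Y \ c ⊆ Y' \ c' →
      Y \ (c ∪ r.top (Y \ c)) ⊆ Y' \ (c' ∪ r.top (Y' \ c')) := by
    rintro r c c' hc x ⟨hx, hxc⟩
    have h1 : x ∈ Y \ c := ⟨hx, fun h => hxc (Or.inl h)⟩
    refine ⟨(hc h1).1, ?_⟩
    rintro (h | h)
    · exact (hc h1).2 h
    · exact hxc (Or.inr (r.mem_top_of_subset hc h h1))
  induction l generalizing c c' f f' with
  | nil => exact hc
  | cons s l ih =>
    rcases s with k | k
    · refine ih _ _ _ _ ?_ (key _ _ _ hc)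
      rintro j (hj | ⟨hj, hn⟩)
      · exact Or.inl (hf hj)
      · exact Or.inr ⟨hj, StrictRanking.top_nonempty_mono _ hc hn⟩
    -- More filled original seats can only close shadow seats, which leaves more contracts unchosen:
    -- the direction needed.
    · refine ih _ _ _ _ hf ?_
      rintro x ⟨hx, hxc⟩
      have h1 : x ∈ Y \ c := ⟨hx, fun h => hxc (Or.inl h)⟩
      refine ⟨(hc h1).1, ?_⟩
      rintro (h | ⟨h1', h2', h3'⟩)
      · exact (hc h1).2 h
      · exact hxc (Or.inr ⟨fun h => h1' (hf h), h2', StrictRanking.mem_top_of_subset _ hc h3' h1⟩)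


/-- Law of aggregate demand for the relaxed procedure. The correction term counts the shadow seats
that are still to come and have lost their capacity by the enlargement of the set of offers. -/
theorem ncard_relaxedFill_le [Finite α] {prio : Seat n → StrictRanking α}
    {Y Y' : Set α} (l : List (Seat n)) (hl : l.Nodup) (c c' : Set α) (f f' : Set (Fin n))
    (hf : f ⊆ f') (hc : Y \ c ⊆ Y' \ c')
    (hcard : c.ncard + {k | k ∈ f' ∧ k ∉ f ∧ Sum.inr k ∈ l}.ncard ≤ c'.ncard) :
    (relaxedFill q prio Y l c f).ncard ≤ (relaxedFill q prio Y' l c' f').ncard := by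
  have pair : ∀ (c t : Set α), t.Subsingleton → Disjoint c t →
      (c ∪ t).ncard = c.ncard + t.ncard ∧ t.ncard ≤ 1 ∧ (t.Nonempty ↔ 0 < t.ncard) := fun c t h1 h2 =>
    ⟨Set.ncard_union_eq h2, Set.ncard_le_one_iff_subsingleton.2 h1, (Set.ncard_pos).symm⟩
  induction l generalizing c c' f f' with
  | nil => simp only [relaxedFill]; omega
  | cons s l ih =>
    -- Applied to the single seat `s`, substitutability gives the inclusion of available contracts
    -- after that seat.
    have hrest := mem_relaxedFill_of_subset (q := q) (prio := prio) [s] c c' f f' hf hc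
    obtain ⟨hs, hl'⟩ := List.nodup_cons.1 hl
    rcases s with k | k
    · simp only [relaxedFill] at hrest ⊢
      set t := (prio (Sum.inl k)).top (Y \ c) with ht
      set t' := (prio (Sum.inl k)).top (Y' \ c') with ht'
      have htt : t.Nonempty → t'.Nonempty := StrictRanking.top_nonempty_mono _ hc
      obtain ⟨e, e1, e2⟩ := pair c t (StrictRanking.top_subsingleton _ _)
        (Set.disjoint_left.2 fun x hx h => h.1.2 hx)
      obtain ⟨e', e1', e2'⟩ := pair c' t' (StrictRanking.top_subsingleton _ _)
        (Set.disjoint_left.2 fun x hx h => h.1.2 hx)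
      refine ih hl' _ _ _ _ ?_ hrest ?_
      · rintro j (hj | ⟨hj, hn⟩)
        · exact Or.inl (hf hj)
        · exact Or.inr ⟨hj, htt hn⟩
      · rw [e, e']
        -- If the seat is filled only under `Y'`, the correction term grows by at most one, paid for
        -- by the extra contract.
        by_cases hn : t'.Nonempty ∧ ¬ t.Nonempty
        · have := Set.ncard_le_ncard (t := insert k {k | k ∈ f' ∧ k ∉ f ∧ Sum.inr k ∈ Sum.inl k :: l})
            (s := {j | j ∈ f' ∪ {l | l = k ∧ t'.Nonempty} ∧ j ∉ f ∪ {l | l = k ∧ t.Nonempty} ∧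
              Sum.inr j ∈ l}) (by
              rintro j ⟨hj | hj, h2, h3⟩
              · exact Or.inr ⟨hj, fun h => h2 (Or.inl h), by simp [h3]⟩
              · exact Or.inl hj.1)
          have h1 := Set.ncard_insert_le k {k | k ∈ f' ∧ k ∉ f ∧ Sum.inr k ∈ Sum.inl k :: l}
          have h2 := e2'.1 hn.1
          have h3 : ¬ 0 < t.ncard := fun h => hn.2 (e2.2 h)
          simp only [List.mem_cons, reduceCtorEq, false_or] at *
          omega
        · have := Set.ncard_le_ncard (t := {k | k ∈ f' ∧ k ∉ f ∧ Sum.inr k ∈ Sum.inl k :: l})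
            (s := {j | j ∈ f' ∪ {l | l = k ∧ t'.Nonempty} ∧ j ∉ f ∪ {l | l = k ∧ t.Nonempty} ∧
              Sum.inr j ∈ l}) (by
              rintro j ⟨hj | hj, h2, h3⟩
              · exact ⟨hj, fun h => h2 (Or.inl h), by simp [h3]⟩
              · exact absurd (Or.inr ⟨hj.1, by_contra fun h => hn ⟨hj.2, h⟩⟩) h2)
          have h2 : 0 < t.ncard → 0 < t'.ncard := fun h => e2'.1 (htt (e2.2 h))
          have h3 : 0 < t'.ncard → 0 < t.ncard := fun h => e2.1 (by
            by_contra h'; exact hn ⟨e2'.2 h, h'⟩)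
          simp only [List.mem_cons, reduceCtorEq, false_or] at *
          omega
    · simp only [relaxedFill] at hrest ⊢
      set t := {z | k ∉ f ∧ q k = true ∧ z ∈ (prio (Sum.inr k)).top (Y \ c)} with ht
      set t' := {z | k ∉ f' ∧ q k = true ∧ z ∈ (prio (Sum.inr k)).top (Y' \ c')} with ht'
      obtain ⟨e, e1, e2⟩ := pair c t
        ((StrictRanking.top_subsingleton (prio (Sum.inr k)) (Y \ c)).anti fun x hx => hx.2.2)
        (Set.disjoint_left.2 fun x hx h => h.2.2.1.2 hx)
      obtain ⟨e', e1', e2'⟩ := pair c' t'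
        ((StrictRanking.top_subsingleton (prio (Sum.inr k)) (Y' \ c')).anti fun x hx => hx.2.2)
        (Set.disjoint_left.2 fun x hx h => h.2.2.1.2 hx)
      refine ih hl' _ _ _ _ hf hrest ?_
      rw [e, e']
      have hsub : {j | j ∈ f' ∧ j ∉ f ∧ Sum.inr j ∈ l} ⊆
          {j | j ∈ f' ∧ j ∉ f ∧ Sum.inr j ∈ Sum.inr k :: l} :=
        fun j hj => ⟨hj.1, hj.2.1, List.mem_cons_of_mem _ hj.2.2⟩
      have hle := Set.ncard_le_ncard hsub
      by_cases hn : t.Nonempty ∧ ¬ t'.Nonempty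
      · obtain ⟨⟨x, hx⟩, hn'⟩ := hn
        -- A shadow seat filled only under `Y` must have been closed by `f'`. It was counted in the
        -- correction term and now leaves it, which offsets the lost contract.
        have hk : k ∈ f' := by
          by_contra hk
          obtain ⟨y, hy⟩ := StrictRanking.top_nonempty_mono _ hc ⟨x, hx.2.2⟩
          exact hn' ⟨y, hk, hx.2.1, hy⟩
        have := Set.ncard_lt_ncard (hsub.ssubset_of_mem_notMem
          (a := k) ⟨hk, hx.1, List.mem_cons_self⟩ fun h => hs h.2.2)
        omega
      · have h2 : 0 < t.ncard → 0 < t'.ncard := fun h => e2'.1 (by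
          by_contra h'; exact hn ⟨e2.2 h, h'⟩)
        omega

end RelaxedFill

/-- A shadow seat has a single location, so it lies in a single block. Aggregate demand needs this:
a processed shadow seat must not return in the correction term. -/
theorem LocationVector.nodup_seatList {n : ℕ} (L : LocationVector n) : L.seatList.Nodup := by
  unfold LocationVector.seatList
  rw [List.nodup_flatMap]
  constructor
  · intro l _
    rw [List.nodup_cons]
    exact ⟨by simp, ((List.nodup_finRange n).filter _).map Sum.inr_injective⟩
  · refine (List.nodup_finRange n).imp ?_
    intro a b hab
    rw [Function.onFun, List.disjoint_left]
    rintro (k | k) h1 h2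
    · simp only [List.mem_cons, Sum.inl.injEq, List.mem_map, reduceCtorEq, and_false, exists_false,
        or_false] at h1 h2
      exact hab (h1.symm.trans h2)
    · simp only [List.mem_cons, reduceCtorEq, List.mem_map, List.mem_filter, List.mem_finRange,
        true_and, decide_eq_true_eq, Sum.inr.injEq, exists_eq_right, false_or] at h1 h2
      exact hab (Fin.ext (by omega))

/-! ### Effect of an improvement on the choice of a seat and of a branch -/

section Improvement

variable {I α : Type*} [Finite α] {agent : α → I} {i : I}

/-- The condition on the two rankings of one seat in an improvement for agent `i`. -/
def StrictRanking.Improves (agent : α → I) (i : I) (r' r : StrictRanking α) : Prop :=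
  (∀ (x : α) (y : Option α), agent x = i → (∀ w ∈ y, agent w ≠ i) →
    r.above (some x) y → r'.above (some x) y) ∧
  ∀ y z : Option α, (∀ w ∈ y, agent w ≠ i) → (∀ w ∈ z, agent w ≠ i) →
    (r.above y z ↔ r'.above y z)

/-- A contract of `i` that beat the winner before the improvement would still beat it afterwards;
the other contracts and `∅` keep their order. -/
theorem StrictRanking.Improves.top_eq {r' r : StrictRanking α} (h : r'.Improves agent i r)
    {S : Set α} (hS : ∀ x ∈ r'.top S, agent x ≠ i) : r.top S = r'.top S := by
  have sub : r'.top S ⊆ r.top S := by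
    intro t ht
    have hi : ∀ w ∈ some t, agent w ≠ i := by simpa using hS t ht
    refine ⟨ht.1, (h.2 _ _ hi (by simp)).2 ht.2.1, fun y hy hyt => ?_⟩
    by_cases hyi : agent y = i
    · refine (r.total (some t) (some y) (by simpa using hyt.symm)).resolve_right fun hab => ?_
      exact r'.asymm (ht.2.2 y hy hyt) (h.1 y _ hyi hi hab)
    · exact (h.2 _ _ hi (by simpa using hyi)).2 (ht.2.2 y hy hyt)
  refine Set.Subset.antisymm (fun x hx => ?_) sub
  have hx0 : r'.above (some x) none := by
    by_cases hxi : agent x = i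
    · exact h.1 x _ hxi (by simp) hx.2.1
    · exact (h.2 _ _ (by simpa using hxi) (by simp)).1 hx.2.1
  obtain ⟨y, hy⟩ := r'.top_nonempty S ⟨x, hx.1, hx0⟩
  rwa [r.top_subsingleton S hx (sub hy)]

theorem relaxedFill_eq_of_improves {n : ℕ} {q : TransferScheme n}
    {prio' prio : Seat n → StrictRanking α} (h : ∀ s, (prio' s).Improves agent i (prio s))
    {Y : Set α} (l : List (Seat n)) (c : Set α) (f : Set (Fin n))
    (hi : ∀ x ∈ relaxedFill q prio' Y l c f, agent x ≠ i) :
    relaxedFill q prio Y l c f = relaxedFill q prio' Y l c f := by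
  induction l generalizing c f with
  | nil => rfl
  | cons s l ih =>
    rcases s with k | k
    · simp only [relaxedFill] at hi ⊢
      rw [(h _).top_eq fun x hx => hi x (subset_relaxedFill l _ _ (Or.inr hx))]
      exact ih _ _ hi
    · simp only [relaxedFill] at hi ⊢
      by_cases hk : k ∉ f ∧ q k = true
      · rw [(h _).top_eq fun x hx => hi x (subset_relaxedFill l _ _ (Or.inr ⟨hk.1, hk.2, hx⟩))]
        exact ih _ _ hi
      · have e : ∀ T : Set α, {z | k ∉ f ∧ q k = true ∧ z ∈ T} = ∅ := fun T =>
          Set.eq_empty_of_forall_notMem fun z hz => hk ⟨hz.1, hz.2.1⟩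
        rw [e] at hi ⊢
        rw [e]
        exact ih _ _ hi

end Improvement

/-! ### Cumulative offers for abstract substitutable completions -/

section OfferState

variable {I B X : Type*} {agent : X → I} {branch : X → B} {P : PrefProfile agent}
  {H H' : Set X → Set X} {C C' : B → ChoiceRule X}

/-- Substitutability of a choice function: rejected contracts remain rejected when more contracts
are offered. -/
structure IsSubstitutable (H : Set X → Set X) : Prop where
  subset : ∀ A, H A ⊆ A
  rejected_mono : ∀ A A', A ⊆ A' → A \ H A ⊆ A' \ H A'

theorem IsSubstitutable.insert_subset (hH : IsSubstitutable H) (A : Set X) (x : X) :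
    H (insert x A) ⊆ insert x (H A) := by
  intro y hy
  rcases hH.subset _ hy with rfl | hyA
  · exact Or.inl rfl
  · by_contra h
    exact (hH.rejected_mono A _ (Set.subset_insert x A) ⟨hyA, fun h' => h (Or.inr h')⟩).2 hy

/-- The invariants of the cumulative offer algorithm when `H` is the joint choice of the branches:
no agent has two contracts chosen, only acceptable contracts have been offered, and all contracts
that an agent prefers to one that she offered have been offered and rejected. -/
structure OfferState (agent : X → I) (P : PrefProfile agent) (H : Set X → Set X) (A : Set X) :
    Prop where
  injOn : Set.InjOn agent (H A)
  acceptable : ∀ (j : I) (x : {x : X // agent x = j}), x.1 ∈ A → (P j).above (some x) none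
  rejected : ∀ (j : I) (x y : {x : X // agent x = j}), x.1 ∈ A → (P j).above (some y) (some x) →
    y.1 ∈ A \ H A

theorem mem_of_above_top {j : I} {r : StrictRanking {x : X // agent x = j}} {A : Set X}
    {x y : {x : X // agent x = j}} (hx : x ∈ r.top {y | y.1 ∉ A})
    (h : r.above (some y) (some x)) : y.1 ∈ A := by
  by_contra hy
  refine r.asymm h (hx.2.2 y hy ?_)
  rintro rfl
  exact r.irrefl _ h

/-- By substitutability the new choice adds at most the new offer, whose agent had nothing chosen.
-/
theorem OfferState.insert_offer (hH : IsSubstitutable H) {A : Set X} (hA : OfferState agent P H A)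
    {j : I} (hj : ∀ y ∈ H A, agent y ≠ j) {x : {x : X // agent x = j}}
    (hx : x ∈ (P j).top {y | y.1 ∉ A}) : OfferState agent P H (insert x.1 A) where
  injOn := by
    refine Set.InjOn.mono (hH.insert_subset A x.1) ?_
    have hxA : x.1 ∉ H A := fun h => hx.1 (hH.subset _ h)
    refine (Set.injOn_insert hxA).2 ⟨hA.injOn, ?_⟩
    rintro ⟨y, hy, e⟩
    exact hj y hy (e.trans x.2)
  acceptable := by
    rintro k y (h | h)
    · obtain rfl : j = k := by rw [← x.2, ← y.2, h]
      obtain rfl : y = x := Subtype.ext h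
      exact hx.2.1
    · exact hA.acceptable k y h
  rejected := by
    rintro k y z (h | h) hzy
    · obtain rfl : j = k := by rw [← x.2, ← y.2, h]
      obtain rfl : y = x := Subtype.ext h
      have hz : z.1 ∈ A := mem_of_above_top hx hzy
      exact hH.rejected_mono _ _ (Set.subset_insert _ _) ⟨hz, fun h => hj _ h z.2⟩
    · exact hH.rejected_mono _ _ (Set.subset_insert _ _) (hA.rejected k y z h hzy)

theorem OfferState.empty (hH : IsSubstitutable H) : OfferState agent P H ∅ where
  injOn := (Set.injOn_empty agent).mono (hH.subset ∅)
  acceptable _ _ h := h.elim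
  rejected _ _ _ h := h.elim

/-- The actual choice is known to equal `H` only where `H` is injective on agents; the invariant
provides this before each step. -/
theorem OfferState.of_reachable (hH : IsSubstitutable H)
    (hC : ∀ A, Set.InjOn agent (H A) → heldContracts branch C A = H A) {A : Set X}
    (h : Relation.ReflTransGen (OfferStep agent branch P C) ∅ A) : OfferState agent P H A := by
  induction h with
  | refl => exact .empty hH
  | tail _ step ih =>
    obtain ⟨j, hj, x, hx, rfl⟩ := step
    rw [hC _ ih.injOn] at hj
    exact ih.insert_offer hH hj hx

/-- Before a contract is offered, the algorithm passes through a state in which its agent holds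
nothing and has offered all contracts that she prefers to it. -/
theorem OfferState.exists_before (hH : IsSubstitutable H)
    (hC : ∀ A, Set.InjOn agent (H A) → heldContracts branch C A = H A) {A : Set X}
    (h : Relation.ReflTransGen (OfferStep agent branch P C) ∅ A) {i : I}
    {x : {x : X // agent x = i}} (hx : x.1 ∈ A) :
    ∃ D, OfferState agent P H D ∧ (∀ y ∈ H D, agent y ≠ i) ∧
      ∀ y, (P i).above (some y) (some x) → y.1 ∈ D := by
  induction h with
  | refl => exact hx.elim
  | @tail D _ hD step ih =>
    obtain ⟨j, hj, z, hz, rfl⟩ := step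
    rcases hx with h | h
    · have hD' := OfferState.of_reachable hH hC hD
      obtain rfl : j = i := by rw [← x.2, ← z.2, h]
      obtain rfl : x = z := Subtype.ext h
      rw [hC _ hD'.injOn] at hj
      exact ⟨D, hD', hj, fun y hy => mem_of_above_top hz hy⟩
    · exact ih h

/-- A state can be completed by offers of the agents other than `i`. -/
theorem OfferState.exists_completion [Finite X] (hH : IsSubstitutable H) (i : I) {A : Set X}
    (hA : OfferState agent P H A) (hi : ∀ y ∈ H A, agent y ≠ i) :
    ∃ E, A ⊆ E ∧ OfferState agent P H E ∧ (∀ y ∈ H E, agent y ≠ i) ∧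
      ∀ j, j ≠ i → (∃ y ∈ H E, agent y = j) ∨
        ∀ x : {x : X // agent x = j}, (P j).above (some x) none → x.1 ∈ E := by
  induction A using WellFoundedGT.induction with
  | ind A ih =>
    by_cases h : ∀ j, j ≠ i → (∃ y ∈ H A, agent y = j) ∨
        ∀ x : {x : X // agent x = j}, (P j).above (some x) none → x.1 ∈ A
    · exact ⟨A, subset_rfl, hA, hi, h⟩
    · push Not at h
      obtain ⟨j, hji, hj, x, hx, hxA⟩ := h
      obtain ⟨m, hm⟩ := (P j).top_nonempty {y | y.1 ∉ A} ⟨x, hxA, hx⟩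
      obtain ⟨E, h1, h2⟩ := ih (insert m.1 A) (Set.ssubset_insert hm.1)
        (hA.insert_offer hH hj hm) fun y hy => by
          rcases hH.insert_subset _ _ hy with rfl | h
          · rwa [m.2]
          · exact hi y h
      exact ⟨E, (Set.subset_insert _ _).trans h1, h2⟩

/-- Offers made along the algorithm are contained in every state that is complete except for the
offers of `i`, as long as the offers of `i` are. -/
theorem OfferState.reachable_subset (hH : IsSubstitutable H)
    (hC : ∀ A, Set.InjOn agent (H A) → heldContracts branch C A = H A) {i : I} {E : Set X}
    (hE : OfferState agent P H E)
    (hend : ∀ j, j ≠ i → (∃ y ∈ H E, agent y = j) ∨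
        ∀ x : {x : X // agent x = j}, (P j).above (some x) none → x.1 ∈ E) {A : Set X}
    (h : Relation.ReflTransGen (OfferStep agent branch P C) ∅ A)
    (hi : ∀ x ∈ A, agent x = i → x ∈ E) : A ⊆ E := by
  induction h with
  | refl => exact Set.empty_subset _
  | @tail D _ hD step ih =>
    have hD' := OfferState.of_reachable hH hC hD
    obtain ⟨j, hj, x, hx, rfl⟩ := step
    rw [hC _ hD'.injOn] at hj
    have hDE := ih fun x hx => hi x (Or.inr hx)
    refine Set.insert_subset ?_ hDE
    by_cases hji : j = i
    · exact hi x.1 (Or.inl rfl) (x.2.trans hji)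
    -- If the agent prefers her contract `w` in `H E` to `x`, then `w` was already rejected from
    -- `D`, hence from `E`, a contradiction. Otherwise `x` is `w`, or is better than `w` and so
    -- already offered in `E`.
    · rcases hend j hji with ⟨w, hw, rfl⟩ | hall
      · by_cases hwx : some ⟨w, rfl⟩ = some x
        · rw [← Option.some.inj hwx]
          exact hH.subset _ hw
        rcases (P (agent w)).total _ _ hwx with hab | hab
        · have hwD : w ∈ D := mem_of_above_top hx hab
          exact absurd hw (hH.rejected_mono _ _ hDE ⟨hwD, fun h => hj w h rfl⟩).2
        · exact (hE.rejected _ ⟨w, rfl⟩ x (hH.subset _ hw) hab).1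
      · exact hall x hx.2.1

theorem exists_isAssignment {Z : Set X} (hZ : Set.InjOn agent Z) (i : I) :
    ∃ a, IsAssignment agent i Z a := by
  by_cases h : ∃ x ∈ Z, agent x = i
  · obtain ⟨x, hx, rfl⟩ := h
    refine ⟨some ⟨x, rfl⟩, fun y => ⟨fun hy => ?_, fun hy => ?_⟩⟩
    · exact congrArg some (Subtype.ext (hZ hx hy y.2.symm))
    · rwa [← Option.some.inj hy]
  · exact ⟨none, fun y => ⟨fun hy => (h ⟨y, hy, y.2⟩).elim, fun hy => by simp at hy⟩⟩

/-- Outcomes of the cumulative offer mechanism are compared for choice profiles with substitutable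
completions `H` and `H'`, where `H` satisfies the law of aggregate demand and agrees with `H'` on
all sets of offers from which `H'` chooses no contract of `i`. -/
theorem cumulativeOffer_weaklyPrefers [Finite X] (hH : IsSubstitutable H)
    (hH' : IsSubstitutable H')
    (hC : ∀ A, Set.InjOn agent (H A) → heldContracts branch C A = H A)
    (hC' : ∀ A, Set.InjOn agent (H' A) → heldContracts branch C' A = H' A)
    (hcard : ∀ A A', A ⊆ A' → (H A).ncard ≤ (H A').ncard) {i : I}
    (himp : ∀ A, (∀ x ∈ H' A, agent x ≠ i) → H A = H' A)
    {Z' Z : Set X} (hZ' : Z' ∈ cumulativeOffer agent branch P C')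
    (hZ : Z ∈ cumulativeOffer agent branch P C) : WeaklyPrefers agent P i Z' Z := by
  obtain ⟨A', hr', hend', rfl⟩ := hZ'
  obtain ⟨A, hr, hend, rfl⟩ := hZ
  have sA' := OfferState.of_reachable hH' hC' hr'
  have sA := OfferState.of_reachable hH hC hr
  unfold OffersEnd at hend hend'
  rw [hC' _ sA'.injOn] at hend' ⊢
  rw [hC _ sA.injOn] at hend ⊢
  obtain ⟨a', ha'⟩ := exists_isAssignment sA'.injOn i
  obtain ⟨a, ha⟩ := exists_isAssignment sA.injOn i
  refine ⟨a', a, ha', ha, ?_⟩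
  by_contra hcon
  push Not at hcon
  have hab : (P i).above a a' := ((P i).total a' a hcon.1).resolve_left hcon.2
  obtain ⟨D, sD, hDi, hD⟩ : ∃ D, OfferState agent P H' D ∧ (∀ y ∈ H' D, agent y ≠ i) ∧
      ∀ y, (P i).above (some y) a' → y.1 ∈ D := by
    rcases a' with _ | z
    -- If `i` ends with nothing, the final state of the improved run serves as `D`.
    · have hno : ∀ y ∈ H' A', agent y ≠ i := fun y hy e => by
        simpa using (ha' ⟨y, e⟩).1 hy
      exact ⟨A', sA', hno, (hend' i).resolve_left fun ⟨y, hy, e⟩ => hno y hy e⟩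
    · exact OfferState.exists_before hH' hC' hr' (hH'.subset _ ((ha' z).2 rfl))
  obtain ⟨x, rfl⟩ : ∃ x, a = some x := by
    rcases a with _ | x
    · rcases a' with _ | z
      · exact ((P i).irrefl _ hab).elim
      · exact ((P i).asymm hab (sA'.acceptable i z (hH'.subset _ ((ha' z).2 rfl)))).elim
    · exact ⟨x, rfl⟩
  have hx : x.1 ∈ H A := (ha x).2 rfl
  obtain ⟨E, hDE, sE', hEi, hEend⟩ := sD.exists_completion hH' i hDi
  have hE := himp E hEi
  -- `E` need not be reachable under `C`; only the invariants are used, and they transfer because `H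
  -- E = H' E`.
  have sE : OfferState agent P H E :=
    ⟨hE ▸ sE'.injOn, sE'.acceptable, fun j y z => hE ▸ sE'.rejected j y z⟩
  rw [← hE] at hEi hEend
  have hAE : A ⊆ E := by
    -- In the old run `i` offers nothing worse than `x`, since otherwise `x` would have been
    -- rejected. Hence all her offers beat `a'` and lie in `D`.
    refine sE.reachable_subset hH hC hEend hr fun y hy hyi => hDE (hD ⟨y, hyi⟩ ?_)
    by_cases hyx : some ⟨y, hyi⟩ = some x
    · rwa [hyx]
    rcases (P i).total _ _ hyx with h | h
    · exact (P i).trans _ _ _ h hab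
    · exact absurd hx (sA.rejected i ⟨y, hyi⟩ x hy h).2
  have hlt : (agent '' H E).ncard < (agent '' H A).ncard := by
    refine Set.ncard_lt_ncard (LE.le.ssubset_of_mem_notMem (a := i) ?_ ⟨x, hx, x.2⟩ ?_)
      (Set.toFinite _)
    · rintro _ ⟨w, hw, rfl⟩
      -- An agent unserved in `H A` has had all her acceptable contracts rejected from `A`, hence
      -- from `E`.
      rcases hend (agent w) with h | hall
      · exact h
      have hwA : w ∈ A := hall ⟨w, rfl⟩ (sE.acceptable _ ⟨w, rfl⟩ (hH.subset _ hw))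
      by_contra hno
      exact (hH.rejected_mono _ _ hAE ⟨hwA, fun h => hno ⟨w, h, rfl⟩⟩).2 hw
    · rintro ⟨w, hw, e⟩
      exact hEi w hw e
  rw [sE.injOn.ncard_image, sA.injOn.ncard_image] at hlt
  exact absurd (hcard A E hAE) (not_le.2 hlt)

end OfferState

/-! ### Combining the branches into one choice function -/

section RelaxedHeld

variable {I B X : Type*} {agent : X → I} {branch : X → B} {n : B → ℕ}
  {L : ∀ b, LocationVector (n b)} {q : ∀ b, TransferScheme (n b)}

/-- The contracts chosen by branch `b` from the offers `A` under the relaxed procedure. -/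
def branchRelaxed (branch : X → B) (L : ∀ b, LocationVector (n b))
    (q : ∀ b, TransferScheme (n b)) (prio : PriorityProfile branch n) (A : Set X) (b : B) :
    Set {x : X // branch x = b} :=
  relaxedFill (q b) (prio b) {x | x.1 ∈ A} (L b).seatList ∅ ∅

/-- The contracts chosen by all branches from the offers `A` under the relaxed procedure. -/
def relaxedHeld (branch : X → B) (L : ∀ b, LocationVector (n b))
    (q : ∀ b, TransferScheme (n b)) (prio : PriorityProfile branch n) (A : Set X) : Set X :=
  {x | ⟨x, rfl⟩ ∈ branchRelaxed branch L q prio A (branch x)}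

theorem mem_relaxedHeld {prio : PriorityProfile branch n} {A : Set X} {b : B}
    {x : {x : X // branch x = b}} :
    x.1 ∈ relaxedHeld branch L q prio A ↔ x ∈ branchRelaxed branch L q prio A b := by
  obtain ⟨x, rfl⟩ := x
  rfl

theorem isSubstitutable_relaxedHeld [Finite X] (prio : PriorityProfile branch n) :
    IsSubstitutable (relaxedHeld branch L q prio) where
  subset A x hx := by
    have : (⟨x, rfl⟩ : {y : X // branch y = branch x}) ∈ {y | y.1 ∈ A} :=
      relaxedFill_subset _ _ _ (Set.empty_subset _) hx
    exact this
  rejected_mono A A' h x hx := by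
    refine mem_relaxedFill_of_subset (q := q (branch x)) (prio := prio (branch x))
      (Y := {y | y.1 ∈ A}) (Y' := {y | y.1 ∈ A'}) (L (branch x)).seatList ∅ ∅ ∅ ∅ subset_rfl ?_
      (a := ⟨x, rfl⟩) hx
    simpa using fun y _ hy => h hy

theorem heldContracts_eq_relaxedHeld [Finite X] (prio : PriorityProfile branch n) {A : Set X}
    (hA : Set.InjOn agent (relaxedHeld branch L q prio A)) :
    heldContracts branch (fun b => sspwctChoice agent branch b (L b) (q b) (prio b)) A =
      relaxedHeld branch L q prio A := by
  have key : ∀ b, sspwctChoice agent branch b (L b) (q b) (prio b) {y | y ∈ A ∧ branch y = b} =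
      Subtype.val '' branchRelaxed branch L q prio A b := by
    intro b
    have hY : {x : {x : X // branch x = b} | x.1 ∈ {y | y ∈ A ∧ branch y = b}} =
        {x | x.1 ∈ A} := by
      ext x
      simp [x.2]
    unfold sspwctChoice
    rw [hY, fillSeats_eq_relaxedFill]
    · rfl
    · exact fun x hx y hy e =>
        Subtype.ext (hA (mem_relaxedHeld.2 hx) (mem_relaxedHeld.2 hy) e)
  ext x
  simp only [heldContracts, key, Set.mem_ofPred_eq]
  constructor
  · rintro ⟨b, y, hy, rfl⟩
    exact mem_relaxedHeld.2 hy
  · exact fun hx => ⟨branch x, ⟨x, rfl⟩, hx, rfl⟩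

theorem ncard_relaxedHeld [Finite X] [Fintype B] (prio : PriorityProfile branch n) (A : Set X) :
    (relaxedHeld branch L q prio A).ncard = ∑ b, (branchRelaxed branch L q prio A b).ncard := by
  classical
  have := Fintype.ofFinite X
  rw [Set.ncard_eq_toFinset_card', Finset.card_eq_sum_card_fiberwise (f := branch)
    (t := Finset.univ) (by simp)]
  refine Finset.sum_congr rfl fun b _ => ?_
  rw [← Set.ncard_image_of_injective _ Subtype.val_injective, ← Set.ncard_coe_finset]
  congr 1
  ext x
  simp only [Finset.coe_filter, Set.mem_toFinset, Set.mem_ofPred_eq, Set.mem_image]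
  constructor
  · rintro ⟨hx, rfl⟩
    exact ⟨⟨x, rfl⟩, hx, rfl⟩
  · rintro ⟨y, hy, rfl⟩
    exact ⟨mem_relaxedHeld.2 hy, y.2⟩

theorem ncard_relaxedHeld_mono [Finite X] [Finite B] (prio : PriorityProfile branch n)
    {A A' : Set X} (h : A ⊆ A') :
    (relaxedHeld branch L q prio A).ncard ≤ (relaxedHeld branch L q prio A').ncard := by
  have := Fintype.ofFinite B
  rw [ncard_relaxedHeld, ncard_relaxedHeld]
  refine Finset.sum_le_sum fun b _ => ?_
  -- Both procedures start with no filled seat, so the correction term is zero.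
  refine ncard_relaxedFill_le _ (L b).nodup_seatList _ _ _ _ subset_rfl ?_ (by simp)
  simpa using fun y _ hy => h hy

theorem relaxedHeld_eq_of_isImprovement [Finite X] {i : I}
    {prio' prio : PriorityProfile branch n} (h : IsImprovement agent branch i prio' prio)
    {A : Set X} (hi : ∀ x ∈ relaxedHeld branch L q prio' A, agent x ≠ i) :
    relaxedHeld branch L q prio A = relaxedHeld branch L q prio' A := by
  have key : ∀ b, branchRelaxed branch L q prio A b = branchRelaxed branch L q prio' A b :=
    fun b => relaxedFill_eq_of_improves (agent := fun x => agent x.1) (i := i) (h b) _ _ _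
      fun x hx => hi x.1 (mem_relaxedHeld.2 hx)
  ext x
  exact Set.ext_iff.1 (key (branch x)) ⟨x, rfl⟩

end RelaxedHeld

theorem theorem2 {I B X : Type*} [Finite I] [Finite B] [Finite X]
    (agent : X → I) (branch : X → B) (n : B → ℕ)
    (L : ∀ b, LocationVector (n b)) (q : ∀ b, TransferScheme (n b)) :
    RespectsImprovements agent branch L q (cumulativeOffer agent branch) := by
  intro i P prio' prio himp Z' hZ' Z hZ
  exact cumulativeOffer_weaklyPrefers (isSubstitutable_relaxedHeld prio)
    (isSubstitutable_relaxedHeld prio') (fun _ => heldContracts_eq_relaxedHeld prio)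
    (fun _ => heldContracts_eq_relaxedHeld prio') (fun _ _ => ncard_relaxedHeld_mono prio)
    (fun _ => relaxedHeld_eq_of_isImprovement himp) hZ' hZ
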